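/- Let $T$ be a topological space and $\theta$ an infinite ordinal. In the open-point game $G_{T,\theta}$, at each stage $\alpha$ Player I chooses a non-empty open set $U_\alpha\subset T$ and then Player II chooses a point $x_\alpha\in U_\alpha$, both knowing all previous moves. The game ends at the first stage $\beta$ with $\overline{\{x_\alpha:\alpha<\beta\}}=T$; Player I wins if this happens at some $\beta<\theta$, otherwise Player II wins. Let $\mathrm{gd}(T)$ be the least infinite cardinal $\lambda$ such that Player I has a winning strategy in $G_{T,\lambda^+}$. Theorem. Let $\kappa$ be an infinite cardinal, let $\sigma\le\kappa$, and let $\{X_\alpha\}_{\alpha<\sigma}$ be a family of topological spaces (equivalently, a family indexed by any set of cardinality at most $\kappa$) with $\mathrm{gd}(X_\alpha)\le\kappa$ for every $\alpha<\sigma$. Assume the following tightness condition: for each non-empty finite subset $\Gamma\subset\sigma$ and each non-empty open subset $U\subset\prod_{\gamma\in\Gamma}X_\gamma$ there is a family $\{V_\beta\}_{\beta<\kappa}$ of open subsets of $\prod_{\gamma\in\Gamma}X_\gamma$ such that, whenever $A\subset\prod_{\gamma\in\Gamma}X_\gamma$ satisfies $$\overline{\pi_{X_\gamma}(A\cap V_\beta)}=\overline{\pi_{X_\gamma}(V_\beta)}\qquad\text{for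 all }\beta<\kappa\text{ and }\gamma\in\Gamma,$$ there is $\gamma\in\Gamma$ with $$\pi_{X_\gamma}(U\setminus\overline{A})\subsetneq\pi_{X_\gamma}(U).$$ Then $\mathrm{gd}\bigl(\prod_{\alpha<\sigma}X_\alpha\bigr)\le\kappa$, where the product carries the product topology. -/

import Mathlib

open Cardinal Ordinal

universe u

namespace OpenPoint

/-- Transfinite sequences of points of `T` of length `α`: the choices `(x_ξ)_{ξ < α}` that
Player II has made before stage `α` of the open-point game on `T`. -/
abbrev History (T : Type u) (α : Ordinal.{u}) : Type (u + 1) :=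
  Set.Iio α → T

/-- The initial segment of length `α` of a sequence of length `β`. -/
def History.restrict {T : Type u} {α β : Ordinal.{u}} (h : α ≤ β) (x : History T β) :
    History T α :=
  fun ξ => x ⟨ξ.1, lt_of_lt_of_le ξ.2 h⟩

/-- The game has ended by stage `α`: the points chosen before stage `α` are dense.
Once this happens it stays true at all later stages. -/
def History.Over {T : Type u} [TopologicalSpace T] {α : Ordinal.{u}} (x : History T α) : Prop :=
  closure (Set.range x) = Set.univ

/-- `s` is a strategy of Player I in the game of length `θ`: at each stage `α < θ` which is
reached (the game is not over yet), it assigns to the choices of Player II made so far a non-empty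
open set. -/
def IsStrategy (T : Type u) [TopologicalSpace T] (θ : Ordinal.{u})
    (s : (α : Ordinal.{u}) → History T α → Set T) : Prop :=
  ∀ α < θ, ∀ x : History T α, ¬ x.Over → IsOpen (s α x) ∧ (s α x).Nonempty

/-- The sequence `x` of length `θ` records choices of Player II against the strategy `s`: as long
as the game is not over, the point `x_α` lies in the open set chosen by Player I at stage `α`.
(The entries after the end of the game are irrelevant.) -/
def Follows {T : Type u} [TopologicalSpace T] {θ : Ordinal.{u}}
    (s : (α : Ordinal.{u}) → History T α → Set T) (x : History T θ) : Prop :=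
  ∀ (α : Ordinal.{u}) (hα : α < θ), ¬ (x.restrict hα.le).Over →
    x ⟨α, hα⟩ ∈ s α (x.restrict hα.le)

/-- Player I has a winning strategy in the open-point game on `T` of length `θ`: a strategy such
that every play against it ends at some stage `β < θ`. -/
def PlayerIWins (T : Type u) [TopologicalSpace T] (θ : Ordinal.{u}) : Prop :=
  ∃ s : (α : Ordinal.{u}) → History T α → Set T, IsStrategy T θ s ∧
    ∀ x : History T θ, Follows s x →
      ∃ (β : Ordinal.{u}) (hβ : β < θ), (x.restrict hβ.le).Over

/-- The cardinal invariant `gd(T)`: the least infinite cardinal `κ` such that Player I has a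
winning strategy in the open-point game on `T` of length `κ⁺`. -/
noncomputable def gd (T : Type u) [TopologicalSpace T] : Cardinal.{u} :=
  sInf {κ : Cardinal.{u} | ℵ₀ ≤ κ ∧ PlayerIWins T (Order.succ κ).ord}

/-- The set of cardinals in the definition of `gd` is never empty, so that its infimum is
attained. -/
theorem gd_set_nonempty (T : Type u) [TopologicalSpace T] :
    {κ : Cardinal.{u} | ℵ₀ ≤ κ ∧ PlayerIWins T (Order.succ κ).ord}.Nonempty := by
  refine ⟨max ℵ₀ #T, le_max_left _ _, fun α x => (closure (Set.range x))ᶜ, ?_, ?_⟩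
  · intro α _ x hx
    exact ⟨isClosed_closure.isOpen_compl, Set.nonempty_compl.2 hx⟩
  · intro x hx
    by_contra! hcon
    have hinj : Function.Injective x := by
      have key : ∀ a b : Set.Iio (Order.succ (max ℵ₀ #T)).ord, a < b → x a ≠ x b := by
        intro a b hab he
        have h1 := hx b.1 b.2 (hcon b.1 b.2)
        exact h1 (he ▸ subset_closure ⟨⟨a.1, hab⟩, rfl⟩)
      intro a b he
      rcases lt_trichotomy a b with h | h | h
      · exact absurd he (key a b h)
      · exact h
      · exact absurd he.symm (key b a h)
    have h2 := Cardinal.mk_le_of_injective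
      (f := fun a => ULift.up.{u + 1} (x a)) (fun a b h => hinj (ULift.up_injective h))
    rw [Cardinal.mk_uLift, Cardinal.mk_Iio_ordinal, Cardinal.card_ord, Cardinal.lift_le] at h2
    exact absurd (h2.trans (le_max_right ℵ₀ #T)) (not_le.2 (Order.lt_succ _))

/-- The fan-type tightness condition on the finite subproducts of a family of spaces: for every
non-empty finite set `Γ` of indices and every non-empty open subset `U` of the product over `Γ`
there are open sets `V β`, `β < κ`, such that every set `A` for which `A ∩ V β` and `V β` have
projections with the same closure, for all `β < κ` and `γ ∈ Γ`, satisfies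
`π_γ (U \ closure A) ⊊ π_γ U` for some `γ ∈ Γ`. -/
def FanTight (κ : Cardinal.{u}) {ι : Type u} (X : ι → Type u) [∀ i, TopologicalSpace (X i)] :
    Prop :=
  ∀ Γ : Finset ι, Γ.Nonempty →
    ∀ U : Set ((γ : Γ) → X γ), IsOpen U → U.Nonempty →
      ∃ V : Set.Iio κ.ord → Set ((γ : Γ) → X γ), (∀ β, IsOpen (V β)) ∧
        ∀ A : Set ((γ : Γ) → X γ),
          (∀ (β : Set.Iio κ.ord) (γ : Γ),
            closure (Function.eval γ '' (A ∩ V β)) = closure (Function.eval γ '' V β)) →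
          ∃ γ : Γ, Function.eval γ '' (U \ closure A) ⊂ Function.eval γ '' U

end OpenPoint

universe v

namespace OpenPoint

/-! Player I's strategy on a factor is run against simulated replies that fall, where possible, in a
given monotone trace `K` of the product history. The moves missing `K` form an open set which is
disjoint from `K` and whose union with `K` is dense. Since the simulation ends before `κ⁺`, this set
freezes along any play of length `κ⁺` (`exists_untouched_const`, `exists_stable_complement`).

If the history is not dense, neither is its projection `A` to some finite subproduct. With
`fullFibers A` as traces, the complements span a non-empty open box `U`, and removing `closure A`
from `U` shrinks none of its projections (`not_eval_image_diff_ssubset`). By tightness some `A ∩ V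
β` then has too small a projection along some `γ`. A second complement, with that projection as
trace, cuts `V β` down to Player I's move.

In a play of length `κ⁺` that is never over, all these choices, at most `κ` many, freeze. The next
reply puts its coordinate into the trace, yet the frozen complement containing that coordinate must
avoid the trace. -/

theorem History.Over.mono {T : Type u} [TopologicalSpace T] {α β : Ordinal.{u}} (h : α ≤ β)
    {x : History T β} (hx : (x.restrict h).Over) : x.Over := by
  refine Set.eq_univ_of_univ_subset ?_
  rw [← show closure (Set.range (x.restrict h)) = Set.univ from hx]
  refine closure_mono ?_
  rintro _ ⟨ξ, rfl⟩
  exact ⟨_, rfl⟩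

/-- Player I keeps a winning strategy when the game is made longer. -/
theorem PlayerIWins.mono {T : Type u} [TopologicalSpace T] {θ θ' : Ordinal.{u}} (h : θ ≤ θ')
    (hT : PlayerIWins T θ) : PlayerIWins T θ' := by
  classical
  obtain ⟨s, hs, hw⟩ := hT
  refine ⟨fun α x => if α < θ then s α x else (closure (Set.range x))ᶜ, ?_, ?_⟩
  · intro α _ x hx
    by_cases hα : α < θ
    · simpa [hα] using hs α hα x hx
    · simpa only [hα, if_false] using ⟨isClosed_closure.isOpen_compl, Set.nonempty_compl.2 hx⟩
  · intro x hx
    obtain ⟨β, hβ, ho⟩ := hw (x.restrict h) (fun α hα hn => by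
      have := hx α (hα.trans_le h) hn
      simp only [hα, if_true] at this
      exact this)
    exact ⟨β, hβ.trans_le h, ho⟩

theorem playerIWins_of_gd_le {T : Type u} [TopologicalSpace T] {κ : Cardinal.{u}}
    (h : gd T ≤ κ) : PlayerIWins T (Order.succ κ).ord :=
  (csInf_mem (gd_set_nonempty T)).2.mono (Cardinal.ord_le_ord.2 (Order.succ_le_succ h))

/-- Fewer than `κ⁺` ordinals below `κ⁺` are bounded below `κ⁺`. -/
theorem exists_bound_lt_succ_ord {κ : Cardinal.{u}} (hκ : ℵ₀ ≤ κ) {β : Type v}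
    (hβ : Cardinal.lift.{u} #β ≤ Cardinal.lift.{v} κ) (f : β → Ordinal.{u})
    (hf : ∀ i, f i < (Order.succ κ).ord) : ∃ α < (Order.succ κ).ord, ∀ i, f i ≤ α := by
  refine ⟨⨆ i, f i, Ordinal.lift_iSup_lt_of_lt_cof ?_ hf, fun i => le_ciSup ?_ i⟩
  · rw [← Ordinal.lift_cof, (isRegular_succ hκ).cof_ord]
    exact hβ.trans_lt (Cardinal.lift_lt.2 (Order.lt_succ κ))
  · exact ⟨(Order.succ κ).ord, by rintro _ ⟨i, rfl⟩; exact (hf i).le⟩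

/-! ### Simulated plays on one factor and their stabilization -/

section Simulation

variable {X : Type u}

/-- The replies of Player II against `s`, if the reply to the open set `O` is always `φ O`. -/
noncomputable def simulate (s : (α : Ordinal.{u}) → History X α → Set X) (φ : Set X → X)
    (η : Ordinal.{u}) : X :=
  φ (s η (fun ξ => simulate s φ ξ.1))
termination_by η
decreasing_by exact ξ.2

/-- The first `η` replies of the play in which Player II replies to `O` with `φ O`. -/
noncomputable def run (s : (α : Ordinal.{u}) → History X α → Set X) (φ : Set X → X)
    (η : Ordinal.{u}) : History X η :=
  fun ξ => simulate s φ ξ.1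

theorem simulate_eq (s : (α : Ordinal.{u}) → History X α → Set X) (φ : Set X → X)
    (η : Ordinal.{u}) : simulate s φ η = φ (s η (run s φ η)) := by
  rw [simulate]; rfl

theorem run_congr (s : (α : Ordinal.{u}) → History X α → Set X) {φ ψ : Set X → X}
    {β : Ordinal.{u}} (h : ∀ η < β, φ (s η (run s φ η)) = ψ (s η (run s φ η))) :
    ∀ η ≤ β, run s φ η = run s ψ η := by
  intro η
  induction η using WellFoundedLT.induction with
  | ind η ih =>
    intro hη
    funext ξ
    have hξ : ξ.1 < β := lt_of_lt_of_le ξ.2 hη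
    change simulate s φ ξ.1 = simulate s ψ ξ.1
    rw [simulate_eq, simulate_eq, ← ih ξ.1 ξ.2 hξ.le]
    exact h _ hξ

theorem exists_run_over [TopologicalSpace X] {θ : Ordinal.{u}}
    {s : (α : Ordinal.{u}) → History X α → Set X} (hs : IsStrategy X θ s)
    (hw : ∀ x : History X θ, Follows s x → ∃ (β : Ordinal.{u}) (hβ : β < θ),
      (x.restrict hβ.le).Over)
    {φ : Set X → X} (hφ : ∀ O : Set X, O.Nonempty → φ O ∈ O) :
    ∃ β < θ, (run s φ β).Over ∧ ∀ η < β, ¬ (run s φ η).Over := by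
  obtain ⟨β, hβ, ho⟩ := hw (run s φ θ) (fun α hα hn => by
    change simulate s φ α ∈ s α (run s φ α)
    rw [simulate_eq]
    exact hφ _ (hs α hα _ hn).2)
  have hne : {η : Ordinal.{u} | (run s φ η).Over}.Nonempty := ⟨β, ho⟩
  exact ⟨sInf _, (csInf_le' (show β ∈ {η : Ordinal.{u} | (run s φ η).Over} from ho)).trans_lt hβ,
    csInf_mem hne, fun η hη ho' => absurd (csInf_le' (show η ∈ {η : Ordinal.{u} | (run s φ η).Over} from ho'))
      (not_le.2 hη)⟩

/-- A reply to `O`: a point of `M` if possible, and then one taken from the first `N ζ` which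
meets `O`. -/
noncomputable def pick [Nonempty X] (N : Ordinal.{u} → Set X) (M O : Set X) : X :=
  open Classical in
  if (O ∩ M).Nonempty then
    Classical.epsilon (· ∈ O ∩ N (sInf {ζ | (O ∩ N ζ).Nonempty}))
  else Classical.epsilon (· ∈ O)

theorem pick_mem [Nonempty X] {N : Ordinal.{u} → Set X} {M O : Set X}
    (hM : (O ∩ M).Nonempty → ∃ ζ, (O ∩ N ζ).Nonempty) (hO : O.Nonempty) : pick N M O ∈ O := by
  unfold pick
  split_ifs with h
  · have : (O ∩ N (sInf {ζ | (O ∩ N ζ).Nonempty})).Nonempty :=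
      csInf_mem (s := {ζ | (O ∩ N ζ).Nonempty}) (hM h)
    exact (Classical.epsilon_spec this).1
  · exact Classical.epsilon_spec hO

theorem pick_mem_of_inter [Nonempty X] {N : Ordinal.{u} → Set X} (hN : Monotone N)
    {α : Ordinal.{u}} {O : Set X} (hO : (O ∩ N α).Nonempty) : pick N (N α) O ∈ N α := by
  unfold pick
  rw [if_pos hO]
  have : (O ∩ N (sInf {ζ | (O ∩ N ζ).Nonempty})).Nonempty :=
    csInf_mem (s := {ζ | (O ∩ N ζ).Nonempty}) ⟨α, hO⟩
  exact hN (csInf_le' hO) (Classical.epsilon_spec this).2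

/-- Choosing from the earliest `N ζ` that meets `O`, rather than from `M`, makes the reply
independent of later growth of the trace. -/
theorem pick_eq_pick [Nonempty X] {N N' : Ordinal.{u} → Set X} {M M' O : Set X} {α : Ordinal.{u}}
    (hN : ∀ ζ ≤ α, N ζ = N' ζ) (hM : (O ∩ M).Nonempty ↔ (O ∩ N α).Nonempty)
    (hM' : (O ∩ M').Nonempty ↔ (O ∩ N α).Nonempty) : pick N M O = pick N' M' O := by
  unfold pick
  by_cases h : (O ∩ N α).Nonempty
  · rw [if_pos (hM.2 h), if_pos (hM'.2 h)]
    have h' : (O ∩ N' α).Nonempty := hN α le_rfl ▸ h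
    have hle : sInf {ζ | (O ∩ N ζ).Nonempty} ≤ α := csInf_le' h
    have hle' : sInf {ζ | (O ∩ N' ζ).Nonempty} ≤ α := csInf_le' h'
    have hmem : (O ∩ N (sInf {ζ | (O ∩ N ζ).Nonempty})).Nonempty :=
      csInf_mem (s := {ζ | (O ∩ N ζ).Nonempty}) ⟨α, h⟩
    have hmem' : (O ∩ N' (sInf {ζ | (O ∩ N' ζ).Nonempty})).Nonempty :=
      csInf_mem (s := {ζ | (O ∩ N' ζ).Nonempty}) ⟨α, h'⟩
    have e : sInf {ζ | (O ∩ N ζ).Nonempty} = sInf {ζ | (O ∩ N' ζ).Nonempty} :=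
      le_antisymm (csInf_le' (show (O ∩ N _).Nonempty from (hN _ hle').symm ▸ hmem'))
        (csInf_le' (show (O ∩ N' _).Nonempty from (hN _ hle) ▸ hmem))
    rw [hN _ hle, e]
  · rw [if_neg (fun hh => h (hM.1 hh)), if_neg (fun hh => h (hM'.1 hh))]

/-- The points of the open sets which Player I plays against the replies `φ` before the end of the
game and which do not meet `M`. -/
def untouched [TopologicalSpace X] (s : (α : Ordinal.{u}) → History X α → Set X)
    (φ : Set X → X) (θ : Ordinal.{u}) (M : Set X) : Set X :=
  {p | ∃ η < θ, ¬ (run s φ η).Over ∧ p ∈ s η (run s φ η) ∧ Disjoint (s η (run s φ η)) M}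

theorem isOpen_untouched [TopologicalSpace X] {θ : Ordinal.{u}}
    {s : (α : Ordinal.{u}) → History X α → Set X} (hs : IsStrategy X θ s) (φ : Set X → X)
    (M : Set X) : IsOpen (untouched s φ θ M) := by
  rw [isOpen_iff_forall_mem_open]
  rintro p ⟨η, hη, hn, hp, hd⟩
  exact ⟨_, fun q hq => ⟨η, hη, hn, hq, hd⟩, (hs η hη _ hn).1, hp⟩

theorem disjoint_untouched [TopologicalSpace X] (s : (α : Ordinal.{u}) → History X α → Set X)
    (φ : Set X → X) (θ : Ordinal.{u}) (M : Set X) : Disjoint (untouched s φ θ M) M := by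
  rw [Set.disjoint_left]
  rintro p ⟨η, -, -, hp, hd⟩
  exact Set.disjoint_left.1 hd hp

/-- The replies up to the end of the simulated play are dense; each lies in `M` or in a move missing
`M`. -/
theorem dense_untouched_union [TopologicalSpace X] {θ : Ordinal.{u}}
    {s : (α : Ordinal.{u}) → History X α → Set X} (hs : IsStrategy X θ s)
    (hw : ∀ x : History X θ, Follows s x → ∃ (β : Ordinal.{u}) (hβ : β < θ),
      (x.restrict hβ.le).Over)
    {φ : Set X → X} (hφ : ∀ O : Set X, O.Nonempty → φ O ∈ O) {M : Set X}
    (hM : ∀ O : Set X, (O ∩ M).Nonempty → φ O ∈ M) : Dense (untouched s φ θ M ∪ M) := by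
  obtain ⟨β, hβ, ho, hlt⟩ := exists_run_over hs hw hφ
  refine (dense_iff_closure_eq.2 (show closure (Set.range (run s φ β)) = Set.univ from ho)).mono ?_
  rintro _ ⟨⟨ξ, hξ⟩, rfl⟩
  have hξ' : ξ < β := hξ
  change simulate s φ ξ ∈ _
  rw [simulate_eq]
  have hn := hlt ξ hξ'
  by_cases h : (s ξ (run s φ ξ) ∩ M).Nonempty
  · exact Or.inr (hM _ h)
  · exact Or.inl ⟨ξ, hξ'.trans hβ, hn, hφ _ (hs ξ (hξ'.trans hβ) _ hn).2,
      Set.disjoint_iff_inter_eq_empty.2 (Set.not_nonempty_iff_eq_empty.1 h)⟩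

/-- Against an increasing sequence of length `κ⁺`, the untouched part of the simulated play is
eventually constant. -/
theorem exists_untouched_const [TopologicalSpace X] [Nonempty X] {κ : Cardinal.{u}}
    (hκ : ℵ₀ ≤ κ) {s : (α : Ordinal.{u}) → History X α → Set X}
    (hs : IsStrategy X (Order.succ κ).ord s)
    (hw : ∀ x : History X (Order.succ κ).ord, Follows s x →
      ∃ (β : Ordinal.{u}) (hβ : β < (Order.succ κ).ord), (x.restrict hβ.le).Over)
    {N : Ordinal.{u} → Set X} (hN : Monotone N) :
    ∃ C : Set X, ∃ α₀ < (Order.succ κ).ord, ∀ α, α₀ ≤ α → α < (Order.succ κ).ord →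
      untouched s (pick N (N α)) (Order.succ κ).ord (N α) = C := by
  set θ := (Order.succ κ).ord with hθ
  set M : Set X := ⋃ ζ ∈ Set.Iio θ, N ζ with hMdef
  have hMN : ∀ O : Set X, (O ∩ M).Nonempty → ∃ ζ < θ, (O ∩ N ζ).Nonempty := by
    rintro O ⟨p, hpO, hpM⟩
    obtain ⟨ζ, hζ, hp⟩ := Set.mem_iUnion₂.1 hpM
    exact ⟨ζ, hζ, p, hpO, hp⟩
  obtain ⟨β, hβ, ho, hlt⟩ := exists_run_over (φ := pick N M) hs hw
    (fun O hO => pick_mem (fun h => (hMN O h).imp fun _ => And.right) hO)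
  -- The play against the full union `M` has at most `κ` moves, and each one meeting `M` meets some
  -- `N ζ` already. Past a common bound `α₀`, `N α` gives the same replies as `M`.
  have hfirst : ∀ ξ : Set.Iio β, ∃ ζ < θ, (s ξ.1 (run s (pick N M) ξ.1) ∩ M).Nonempty →
      (s ξ.1 (run s (pick N M) ξ.1) ∩ N ζ).Nonempty := by
    intro ξ
    by_cases h : (s ξ.1 (run s (pick N M) ξ.1) ∩ M).Nonempty
    · obtain ⟨ζ, hζ, hh⟩ := hMN _ h
      exact ⟨ζ, hζ, fun _ => hh⟩
    · exact ⟨β, hβ, fun hh => absurd hh h⟩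
  choose f hfθ hf using hfirst
  obtain ⟨α₀, hα₀, hle⟩ := exists_bound_lt_succ_ord hκ (by
    rw [Cardinal.mk_Iio_ordinal, Cardinal.lift_id'.{u, u+1}, Cardinal.lift_le]
    exact Order.lt_succ_iff.1 (Cardinal.lt_ord.1 hβ)) f hfθ
  refine ⟨untouched s (pick N M) θ M, α₀, hα₀, fun α h0 hα => ?_⟩
  have hiff : ∀ η < β, ((s η (run s (pick N M) η) ∩ M).Nonempty ↔
      (s η (run s (pick N M) η) ∩ N α).Nonempty) := fun η hη =>
    ⟨fun h => (hf ⟨η, hη⟩ h).mono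
        (Set.inter_subset_inter_right _ (hN ((hle ⟨η, hη⟩).trans h0))),
      fun h => h.mono (Set.inter_subset_inter_right _
        (Set.subset_biUnion_of_mem (u := fun ζ => N ζ) (show α ∈ Set.Iio θ from hα)))⟩
  have hrun := run_congr s (φ := pick N M) (ψ := pick N (N α)) (β := β) (fun η hη =>
    pick_eq_pick (fun _ _ => rfl) (hiff η hη) Iff.rfl)
  have hbefore : ∀ φ : Set X → X, (run s φ β).Over → ∀ η, ¬ (run s φ η).Over → η < β := by
    intro φ ho η hn
    by_contra hcon
    exact hn (History.Over.mono (not_lt.1 hcon) (x := run s φ η) ho)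
  have hdisj : ∀ η < β, (Disjoint (s η (run s (pick N M) η)) M ↔
      Disjoint (s η (run s (pick N M) η)) (N α)) := fun η hη => by
    rw [← not_iff_not, Set.not_disjoint_iff_nonempty_inter, Set.not_disjoint_iff_nonempty_inter]
    exact hiff η hη
  ext p
  constructor
  · rintro ⟨η, hη, hn, hp, hd⟩
    have hηβ := hbefore _ (hrun β le_rfl ▸ ho) η hn
    rw [← hrun η hηβ.le] at hn hp hd
    exact ⟨η, hη, hn, hp, (hdisj η hηβ).2 hd⟩
  · rintro ⟨η, hη, hn, hp, hd⟩
    have hηβ := hbefore _ ho η hn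
    have hd' := (hdisj η hηβ).1 hd
    rw [hrun η hηβ.le] at hn hp hd'
    exact ⟨η, hη, hn, hp, hd'⟩

end Simulation

/-! ### Stable open complements of traces of a history -/

/-- The points which a history records before stage `ζ`. -/
def History.before {T : Type u} {α : Ordinal.{u}} (h : History T α) (ζ : Ordinal.{u}) : Set T :=
  {p | ∃ ξ : Set.Iio α, ξ.1 < ζ ∧ h ξ = p}

theorem History.before_mono {T : Type u} {α : Ordinal.{u}} (h : History T α) :
    Monotone h.before := by
  rintro ζ ζ' hζ p ⟨ξ, hξ, rfl⟩
  exact ⟨ξ, hξ.trans_le hζ, rfl⟩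

theorem History.before_self {T : Type u} {α : Ordinal.{u}} (h : History T α) :
    h.before α = Set.range h := by
  ext p
  exact ⟨fun ⟨ξ, _, hp⟩ => ⟨ξ, hp⟩, fun ⟨ξ, hp⟩ => ⟨ξ, ξ.2, hp⟩⟩

theorem History.before_restrict {T : Type u} {α β ζ : Ordinal.{u}} (hαβ : α ≤ β)
    (x : History T β) (hζ : ζ ≤ α) : (x.restrict hαβ).before ζ = x.before ζ := by
  ext p
  constructor
  · rintro ⟨ξ, hξ, rfl⟩
    exact ⟨⟨ξ.1, lt_of_lt_of_le ξ.2 hαβ⟩, hξ, rfl⟩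
  · rintro ⟨ξ, hξ, rfl⟩
    exact ⟨⟨ξ.1, hξ.trans_le hζ⟩, hξ, rfl⟩

/-- If Player I wins on `X`, then to every history in another space `T` one can assign an open set
which complements the traces `K` of the history on `X` to a dense set, and which is eventually
constant along every sequence of length `κ⁺`. -/
theorem exists_stable_complement {X T : Type u} [TopologicalSpace X] {κ : Cardinal.{u}}
    (hκ : ℵ₀ ≤ κ) (hX : PlayerIWins X (Order.succ κ).ord) (K : Set T → Set X)
    (hK : Monotone K) :
    ∃ Ψ : (α : Ordinal.{u}) → History T α → Set X,
      (∀ α h, IsOpen (Ψ α h)) ∧ (∀ α h, Disjoint (Ψ α h) (K (Set.range h))) ∧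
      (∀ α h, Dense (Ψ α h ∪ K (Set.range h))) ∧
      ∀ x : History T (Order.succ κ).ord, ∃ C : Set X, ∃ α₀ < (Order.succ κ).ord,
        ∀ (α : Ordinal.{u}) (hα : α < (Order.succ κ).ord), α₀ ≤ α →
          Ψ α (x.restrict hα.le) = C := by
  obtain ⟨s, hs, hw⟩ := hX
  rcases isEmpty_or_nonempty X with hX | hX
  · refine ⟨fun _ _ => ∅, fun _ _ => isOpen_empty, fun _ _ => by simp, fun _ _ p => (hX.false p).elim,
      fun x => ⟨∅, 0, ?_, fun _ _ _ => rfl⟩⟩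
    exact (Cardinal.isSuccLimit_ord (isRegular_succ hκ).aleph0_le).bot_lt
  have hmono : ∀ {α : Ordinal.{u}} (h : History T α), Monotone fun ζ => K (h.before ζ) :=
    fun h => hK.comp h.before_mono
  refine ⟨fun α h => untouched s (pick (fun ζ => K (h.before ζ)) (K (h.before α)))
    (Order.succ κ).ord (K (h.before α)), fun α h => isOpen_untouched hs _ _, fun α h => ?_,
    fun α h => ?_, fun x => ?_⟩
  · rw [← h.before_self]
    exact disjoint_untouched _ _ _ _
  · rw [← h.before_self]
    exact dense_untouched_union hs hw (fun O hO => pick_mem (fun hh => ⟨α, hh⟩) hO)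
      (fun O hO => pick_mem_of_inter (hmono h) hO)
  · obtain ⟨C, α₀, hα₀, hC⟩ := exists_untouched_const hκ hs hw (hmono x)
    refine ⟨C, α₀, hα₀, fun α hα h0 => ?_⟩
    rw [← hC α h0 hα]
    have hN : ∀ ζ ≤ α, K ((x.restrict hα.le).before ζ) = K (x.before ζ) := fun ζ hζ => by
      rw [History.before_restrict hα.le x hζ]
    -- The truncated history and `x` agree up to stage `α`, and `pick` looks no further.
    have hp : pick (fun ζ => K ((x.restrict hα.le).before ζ)) (K (x.before α)) =
        pick (fun ζ => K (x.before ζ)) (K (x.before α)) := by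
      funext O
      exact pick_eq_pick (α := α) hN (by rw [hN α le_rfl]) (by rw [hN α le_rfl])
    simp only [hN α le_rfl, hp]

/-! ### Boxes and projections in finite products -/

section FiniteProduct

variable {J : Type u} {Y : J → Type u} [∀ j, TopologicalSpace (Y j)]

/-- The points of the factor `Y j` whose fibre lies in the closure of `A`. -/
def fullFibers (A : Set ((j : J) → Y j)) (j : J) : Set (Y j) :=
  {p | ∀ z : (j : J) → Y j, z j = p → z ∈ closure A}

theorem fullFibers_mono (j : J) :
    Monotone fun A : Set ((j : J) → Y j) => fullFibers A j :=
  fun _ _ h _ hp z hz => closure_mono h (hp z hz)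

/-- A side `u j` cannot contain a point of `fullFibers A j`: moving `z` to that coordinate stays in
the box, hence off `closure A`. So density forces `u j` to meet `G j`. -/
theorem exists_box [Finite J] {A : Set ((j : J) → Y j)} {G : (j : J) → Set (Y j)}
    (hG : ∀ j, Dense (G j ∪ fullFibers A j)) {z : (j : J) → Y j} (hz : z ∉ closure A) :
    ∃ u : (j : J) → Set (Y j), z ∈ Set.univ.pi u ∧ Set.univ.pi u ⊆ (closure A)ᶜ ∧
      ∀ j, (u j ∩ G j).Nonempty := by
  classical
  obtain ⟨u, hu, hsub⟩ := isOpen_pi_iff'.1 (isClosed_closure (s := A)).isOpen_compl z hz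
  refine ⟨u, fun j _ => (hu j).2, hsub, fun j => ?_⟩
  obtain ⟨r, hr, hrG | hrK⟩ := (hG j).inter_open_nonempty _ (hu j).1 ⟨_, (hu j).2⟩
  · exact ⟨r, hr, hrG⟩
  · refine absurd (hrK (Function.update z j r) (Function.update_self j r z)) (hsub fun i _ => ?_)
    by_cases h : i = j
    · subst h
      simpa using hr
    · simpa [h] using (hu i).2

theorem nonempty_pi_of_dense_union [Finite J] {A : Set ((j : J) → Y j)} {G : (j : J) → Set (Y j)}
    (hG : ∀ j, Dense (G j ∪ fullFibers A j)) (hA : ¬ Dense A) : (Set.univ.pi G).Nonempty := by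
  obtain ⟨z, hz⟩ : ∃ z, z ∉ closure A := by
    by_contra! h
    exact hA h
  obtain ⟨u, -, -, hne⟩ := exists_box hG hz
  choose w hw using hne
  exact ⟨w, fun j _ => (hw j).2⟩

/-- A coordinate `y j` in `G j` has a fibre point off `closure A`. In a box around that point, the
other coordinates can be moved into the sets `G i` without changing `y j`. -/
theorem not_eval_image_diff_ssubset [Finite J] {A : Set ((j : J) → Y j)} {G : (j : J) → Set (Y j)}
    (hG : ∀ j, Dense (G j ∪ fullFibers A j)) (hd : ∀ j, Disjoint (G j) (fullFibers A j)) (j : J) :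
    ¬ (Function.eval j '' (Set.univ.pi G \ closure A) ⊂ Function.eval j '' Set.univ.pi G) := by
  classical
  intro hss
  obtain ⟨p, ⟨y, hy, rfl⟩, hp⟩ := Set.exists_of_ssubset hss
  have hyK : y j ∉ fullFibers A j := Set.disjoint_left.1 (hd j) (hy j trivial)
  obtain ⟨z, hzj, hz⟩ : ∃ z : (j : J) → Y j, z j = y j ∧ z ∉ closure A := by
    by_contra! h
    exact hyK h
  obtain ⟨u, hzu, hsub, hne⟩ := exists_box hG hz
  choose w hw using hne
  refine hp ⟨Function.update w j (y j), ⟨fun i _ => ?_, hsub fun i _ => ?_⟩, by simp⟩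
  · by_cases h : i = j
    · subst h
      simpa using hy i trivial
    · simpa [h] using (hw i).2
  · by_cases h : i = j
    · subst h
      simpa [← hzj] using hzu i trivial
    · simpa [h] using (hw i).1

theorem nonempty_inter_eval_preimage {A V : Set ((j : J) → Y j)} (hV : IsOpen V) {j : J}
    {G : Set (Y j)}
    (hG : Dense (G ∪ (Function.eval j '' (A ∩ V) ∪ (Function.eval j '' V)ᶜ)))
    (hne : closure (Function.eval j '' (A ∩ V)) ≠ closure (Function.eval j '' V)) :
    (V ∩ Function.eval j ⁻¹' G).Nonempty := by
  obtain ⟨p, hpV, hp⟩ : ∃ p ∈ Function.eval j '' V, p ∉ closure (Function.eval j '' (A ∩ V)) := by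
    by_contra! h
    exact hne (subset_antisymm (closure_mono (Set.image_mono Set.inter_subset_right))
      (closure_minimal h isClosed_closure))
  obtain ⟨q, ⟨hqV, hq⟩, hqG | hqA | hqV'⟩ := hG.inter_open_nonempty _
    ((isOpenMap_eval j V hV).inter (isClosed_closure (s := Function.eval j '' (A ∩ V))).isOpen_compl)
    ⟨p, hpV, hp⟩
  · obtain ⟨y, hy, rfl⟩ := hqV
    exact ⟨y, hy, hqG⟩
  · exact absurd (subset_closure hqA) hq
  · exact absurd hqV hqV'

end FiniteProduct

/-! ### From finite subproducts to the full product: the winning strategy -/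

theorem exists_finset_not_dense {ι : Type u} [Nonempty ι] {X : ι → Type u}
    [∀ i, TopologicalSpace (X i)] {A : Set ((i : ι) → X i)} (hA : ¬ Dense A) :
    ∃ Γ : Finset ι, Γ.Nonempty ∧ ¬ Dense (Γ.restrict '' A) := by
  classical
  obtain ⟨t, ht⟩ : ∃ t, t ∉ closure A := by
    by_contra! h
    exact hA h
  obtain ⟨I, u, hu, hsub⟩ := isOpen_pi_iff.1 (isClosed_closure (s := A)).isOpen_compl t ht
  let i₀ : ι := Classical.arbitrary ι
  refine ⟨insert i₀ I, Finset.insert_nonempty _ _, fun hd => ?_⟩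
  let v : ι → Set (Π i, X i) := fun i => {y | i ∈ I → y i ∈ u i}
  obtain ⟨_, hy, a, ha, rfl⟩ := hd.inter_open_nonempty
    (Set.univ.pi fun γ : ↥(insert i₀ I) => {p : X γ | γ.1 ∈ I → p ∈ u γ})
    (isOpen_set_pi Set.finite_univ fun γ _ => by
      by_cases h : γ.1 ∈ I
      · simpa [h] using (hu _ h).1
      · simp [h])
    ⟨(insert i₀ I).restrict t, fun γ _ h => (hu _ h).2⟩
  exact hsub (fun i hi => hy ⟨i, Finset.mem_insert_of_mem hi⟩ trivial hi) (subset_closure ha)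

theorem surjective_restrict {ι : Type u} {X : ι → Type u} [Nonempty ((i : ι) → X i)]
    (Γ : Finset ι) : Function.Surjective (Γ.restrict : ((i : ι) → X i) → (γ : Γ) → X γ) := by
  classical
  intro y
  refine ⟨fun i => if h : i ∈ Γ then y ⟨i, h⟩ else Classical.arbitrary ((i : ι) → X i) i, ?_⟩
  funext γ
  simp

theorem playerIWins_of_unique {T : Type u} [TopologicalSpace T] [Unique T] {θ : Ordinal.{u}}
    (hθ : Order.IsSuccLimit θ) : PlayerIWins T θ := by
  refine ⟨fun _ _ => Set.univ, fun _ _ _ _ => ⟨isOpen_univ, Set.univ_nonempty⟩, fun x _ => ?_⟩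
  have h1 : Order.succ (0 : Ordinal.{u}) < θ := hθ.succ_lt hθ.bot_lt
  refine ⟨_, h1, ?_⟩
  refine Set.eq_univ_of_univ_subset (subset_trans ?_ subset_closure)
  intro t _
  exact ⟨⟨0, Set.mem_Iio.2 (Order.lt_succ _)⟩, Subsingleton.elim _ _⟩

/-- Player I wins on a product of at most `κ` spaces on which he wins, if the finite subproducts
are tight. -/
theorem playerIWins_pi {ι : Type u} {κ : Cardinal.{u}} (hκ : ℵ₀ ≤ κ) (hι : #ι ≤ κ)
    (X : ι → Type u) [∀ i, TopologicalSpace (X i)]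
    (hX : ∀ i, PlayerIWins (X i) (Order.succ κ).ord) (htight : FanTight κ X) :
    PlayerIWins ((i : ι) → X i) (Order.succ κ).ord := by
  classical
  have hlim : Order.IsSuccLimit (Order.succ κ).ord :=
    Cardinal.isSuccLimit_ord (isRegular_succ hκ).aleph0_le
  rcases isEmpty_or_nonempty ι with hι₀ | hι₀
  · exact playerIWins_of_unique hlim
  have hfin : #(Finset ι) ≤ κ := by
    rcases finite_or_infinite ι with h | h
    · exact (Cardinal.mk_le_aleph0 (α := Finset ι)).trans hκ
    · rwa [Cardinal.mk_finset_of_infinite]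
  have hsigma : #(Σ Γ : Finset ι, Γ) ≤ κ := by
    rw [Cardinal.mk_sigma]
    refine (Cardinal.sum_le_sum _ _
      fun Γ : Finset ι => (Cardinal.mk_le_aleph0 (α := Γ)).trans hκ).trans ?_
    rw [Cardinal.sum_const']
    exact Cardinal.mul_le_of_le hκ hfin le_rfl
  choose Ψ hΨo hΨd hΨdense hΨstab using fun (Γ : Finset ι) (γ : Γ) =>
    exists_stable_complement hκ (hX γ)
      (fun E : Set ((i : ι) → X i) => fullFibers (Γ.restrict '' E) γ)
      (fun _ _ h => fullFibers_mono γ (Set.image_mono h))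
  choose V hVo hV using fun (Γ : Finset ι) (U : {U : Set ((γ : Γ) → X γ) //
    Γ.Nonempty ∧ IsOpen U ∧ U.Nonempty}) => htight Γ U.2.1 U.1 U.2.2.1 U.2.2.2
  -- `Φ` is set up for every `W`, because the sets `V` depend on the history through `U`; stability
  -- holds for each fixed `W`.
  choose Φ hΦo hΦd hΦdense hΦstab using
    fun (Γ : Finset ι) (W : Set ((γ : Γ) → X γ)) (γ : Γ) =>
    exists_stable_complement hκ (hX γ)
      (fun E : Set ((i : ι) → X i) => Function.eval γ '' (Γ.restrict '' E ∩ W) ∪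
        (Function.eval γ '' W)ᶜ)
      (fun E E' h => Set.union_subset_union_left _
        (Set.image_mono (Set.inter_subset_inter_left _ (Set.image_mono h))))
  let U : (Γ : Finset ι) → (α : Ordinal.{u}) → History ((i : ι) → X i) α →
    Set ((γ : Γ) → X γ) := fun Γ α h => Set.univ.pi fun γ => Ψ Γ γ α h
  let IsMove : (α : Ordinal.{u}) → History ((i : ι) → X i) α → Set ((i : ι) → X i) → Prop :=
    fun α h O => ∃ (Γ : Finset ι) (hU : Γ.Nonempty ∧ IsOpen (U Γ α h) ∧ (U Γ α h).Nonempty)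
      (β : Set.Iio κ.ord) (γ : Γ),
      O = Γ.restrict ⁻¹' (V Γ ⟨_, hU⟩ β ∩ Function.eval γ ⁻¹' Φ Γ (V Γ ⟨_, hU⟩ β) γ α h)
  have hmove : ∀ (α : Ordinal.{u}) (h : History ((i : ι) → X i) α), ¬ h.Over →
      ∃ O, IsMove α h O ∧ IsOpen O ∧ O.Nonempty := by
    intro α h hn
    have hA : ¬ Dense (Set.range h) := fun hd => hn hd.closure_eq
    have hT : Nonempty ((i : ι) → X i) := by
      by_contra hT
      exact hA fun t => (hT ⟨t⟩).elim
    obtain ⟨Γ, hΓ, hΓA⟩ := exists_finset_not_dense hA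
    have hU : Γ.Nonempty ∧ IsOpen (U Γ α h) ∧ (U Γ α h).Nonempty :=
      ⟨hΓ, isOpen_set_pi Set.finite_univ fun γ _ => hΨo Γ γ α h,
        nonempty_pi_of_dense_union (fun γ => hΨdense Γ γ α h) hΓA⟩
    obtain ⟨β, γ, hne⟩ : ∃ (β : Set.Iio κ.ord) (γ : Γ),
        closure (Function.eval γ '' (Γ.restrict '' Set.range h ∩ V Γ ⟨_, hU⟩ β)) ≠
          closure (Function.eval γ '' V Γ ⟨_, hU⟩ β) := by
      by_contra! hall
      obtain ⟨γ, hγ⟩ := hV Γ ⟨_, hU⟩ _ hall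
      exact not_eval_image_diff_ssubset (fun γ => hΨdense Γ γ α h) (fun γ => hΨd Γ γ α h) γ hγ
    refine ⟨_, ⟨Γ, hU, β, γ, rfl⟩, ?_, ?_⟩
    · exact ((hVo Γ ⟨_, hU⟩ β).inter ((hΦo Γ _ γ α h).preimage (continuous_apply γ))).preimage
        (continuous_pi fun γ => continuous_apply γ.1)
    · exact (nonempty_inter_eval_preimage (hVo Γ ⟨_, hU⟩ β) (hΦdense Γ _ γ α h) hne).preimage
        (surjective_restrict Γ)
  refine ⟨fun α h => if hn : h.Over then ∅ else (hmove α h hn).choose, fun α _ h hn => ?_,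
    fun x hx => ?_⟩
  · beta_reduce
    rw [dif_neg hn]
    exact (hmove α h hn).choose_spec.2
  by_contra! hover
  choose C a ha hC using fun (Γ : Finset ι) (γ : Γ) => hΨstab Γ γ x
  obtain ⟨a₁, ha₁, hle₁⟩ := exists_bound_lt_succ_ord hκ (β := Σ Γ : Finset ι, Γ) (by
      rwa [Cardinal.lift_id, Cardinal.lift_id]) (fun i => a i.1 i.2) (fun i => ha i.1 i.2)
  have hUC : ∀ Γ (α : Ordinal.{u}) (hα : α < (Order.succ κ).ord), a₁ ≤ α →
      U Γ α (x.restrict hα.le) = Set.univ.pi (C Γ) := fun Γ α hα h1 =>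
    congrArg (Set.univ.pi ·) (funext fun γ => hC Γ γ α hα ((hle₁ ⟨Γ, γ⟩).trans h1))
  -- The final values of the sets `V`, once `U` is frozen: only `κ` many, so a common bound exists
  -- for their `Φ`. The value `∅` is never used by a move.
  let W : (Γ : Finset ι) → Set.Iio κ.ord → Set ((γ : Γ) → X γ) := fun Γ β =>
    if hU : Γ.Nonempty ∧ IsOpen (Set.univ.pi (C Γ)) ∧ (Set.univ.pi (C Γ)).Nonempty
    then V Γ ⟨_, hU⟩ β else ∅
  choose D b hb hD using fun (Γ : Finset ι) (β : Set.Iio κ.ord) (γ : Γ) => hΦstab Γ (W Γ β) γ x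
  obtain ⟨a₂, ha₂, hle₂⟩ := exists_bound_lt_succ_ord hκ
    (β := Set.Iio κ.ord × Σ Γ : Finset ι, Γ) (by
      have h := Cardinal.lift_le.{u + 1}.2 hsigma
      rw [Cardinal.lift_id'.{u, u + 1}, Cardinal.mk_prod, Cardinal.mk_Iio_ordinal,
        Cardinal.card_ord, Cardinal.lift_lift]
      exact Cardinal.mul_le_of_le (Cardinal.aleph0_le_lift.2 hκ) le_rfl h)
    (fun i => b i.2.1 i.1 i.2.2) (fun i => hb i.2.1 i.1 i.2.2)
  have hα : max a₁ a₂ < (Order.succ κ).ord := max_lt ha₁ ha₂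
  have hα' : Order.succ (max a₁ a₂) < (Order.succ κ).ord := hlim.succ_lt hα
  have hn := hover _ hα
  have hxα := hx _ hα hn
  simp only [dif_neg hn] at hxα
  obtain ⟨Γ, hU, β, γ, hO⟩ := (hmove _ _ hn).choose_spec.1
  rw [hO] at hxα
  obtain ⟨hxV, hxΦ⟩ := hxα
  have hW : V Γ ⟨_, hU⟩ β = W Γ β := by
    have e := hUC Γ _ hα (le_max_left _ _)
    have hU' := e ▸ hU
    simp only [W, dif_pos hU']
    congr 2
  rw [hW] at hxV hxΦ
  have hle := (hle₂ ⟨β, Γ, γ⟩).trans (le_max_right a₁ a₂)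
  change _ ∈ Φ Γ (W Γ β) γ _ _ at hxΦ
  -- Passing to the successor stage leaves the frozen set unchanged, but now the history includes
  -- the reply just made, so its coordinate belongs to the trace.
  rw [hD Γ β γ _ hα hle, ← hD Γ β γ _ hα' (hle.trans (Order.le_succ _))] at hxΦ
  exact Set.disjoint_left.1 (hΦd Γ (W Γ β) γ _ _) hxΦ
    (Or.inl ⟨_, ⟨⟨_, ⟨⟨_, Set.mem_Iio.2 (Order.lt_succ _)⟩, rfl⟩, rfl⟩, hxV⟩, rfl⟩)

end OpenPoint

theorem mainTheorem1 {ι : Type u} (κ : Cardinal.{u}) (hκ : ℵ₀ ≤ κ) (hι : #ι ≤ κ)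
    (X : ι → Type u) [∀ i, TopologicalSpace (X i)]
    (hgd : ∀ i, OpenPoint.gd (X i) ≤ κ) (htight : OpenPoint.FanTight κ X) :
    OpenPoint.gd ((i : ι) → X i) ≤ κ :=
  csInf_le' ⟨hκ, OpenPoint.playerIWins_pi hκ hι X
    (fun i => OpenPoint.playerIWins_of_gd_le (hgd i)) htight⟩
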